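/- **Conventions.** Let $\mathbb{Q}$ denote the real quaternions and $U(\mathbb{Q})=\{q\in\mathbb{Q}:|q|=1\}$. A $U(\mathbb{Q})$-gain graph $\widetilde G$ is a finite simple graph together with gains $\varphi_{uv}\in U(\mathbb{Q})$ on its oriented edges such that $\varphi_{vu}=\varphi_{uv}^{-1}$. Its adjacency matrix has entries $\varphi_{uv}$ for adjacent $u,v$ and $0$ otherwise, and its rank $r(\widetilde G)$ is the left row rank of this matrix. The gain of a cycle is $\varphi(v_1v_2\cdots v_nv_1)=\varphi_{v_1v_2}\varphi_{v_2v_3}\cdots\varphi_{v_{n-1}v_n}\varphi_{v_nv_1}$. A cycle $C$ of even length $n$ is of Type 1 if $\varphi(C)=(-1)^{n/2}$ and of Type 2 otherwise; a cycle $C$ of odd length $n$ is of Type 4 if $\mathrm{Re}\big((-1)^{(n-1)/2}\varphi(C)\big)=0$. Two gain graphs with the same underlying graph are switching equivalent if their gains satisfy $\varphi'_{uv}=\xi(u)^{-1}\varphi_{uv}\xi(v)$ for some function $\xi$ from the vertices to $U(\mathbb{Q})$; graphs are identified up to renaming of vertices. Distinct vertices $x,y$ are multiple vertices if $N(x)=N(y)$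 and there is $k\in\mathbb{Q}\setminus\{0\}$ with $\varphi_{xz}=k\varphi_{yz}$ for all $z\in N(x)$. A reduction deletes a vertex that has a multiple vertex in the current graph. A reduct of $\widetilde G$ is any gain graph obtained from $\widetilde G$ by finitely many (possibly zero) successive reductions; a reduct without multiple vertices is the reduced graph of $\widetilde G$. **Theorem.** Let $\widetilde G$ be a connected $U(\mathbb{Q})$-gain graph with girth $g=4$. Then $r(\widetilde G)=g=4$ if one of the following holds. (a) $\widetilde G$ is a cycle $\widetilde C_4$ of Type 2. (b) $\widetilde G$ is a cycle $\widetilde C_4$, with any gains, with a pendant star attached at exactly one vertex or at exactly two nonadjacent vertices. (Attaching a pendant star at $v$ means identifying the centre of a star with at least one leaf with $v$.) (c) $\widetilde G$ is obtained from a cycle $\widetilde C_4$ of Type 1 and a star with $q\ge 1$ leaves by adding an edge that joins a vertex of the cycle to the centre of the star. (d) Some reduct of $\widetilde G$ (for instance its reduced graph, or $\widetilde G$ itself) is switching equivalent to one of the following gain graphs, given by their edges and gain conditions: - $\widetilde G_3$: vertices $1,\dots,7$, edges $12,24,43,31,45,56,67,74$ (two 4-cycles with a common vertex); the cycles $1\,2\,4\,3$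 and $4\,5\,6\,7$ are of Type 1; - $\widetilde G_8$: vertices $1,\dots,6$, edges $12,23,34,45,56,61,25$; $\varphi(v_1v_2v_3v_4v_5v_6v_1)-\varphi(v_1v_2v_5v_6v_1)+1=0$; - $\widetilde G_9$: the complete bipartite graph $K_{2,3}$ with vertices $1,\dots,5$ and edges $12,23,34,41,25,54$; either the cycle $1\,2\,3\,4$ is of Type 1 and the cycle $1\,2\,5\,4$ is of Type 2, or the cycle $1\,2\,3\,4$ is of Type 2 and the cycle $1\,2\,5\,4$ is of Type 1 or 2; - $\widetilde G_{10}$: vertices $1,\dots,6$, edges $12,23,34,45,51,26,65$; the cycle $1\,2\,6\,5$ is of Type 1 and the cycle $1\,2\,3\,4\,5$ is of Type 4; - $\widetilde G_{11}$: vertices $1,\dots,7$, edges $12,23,34,45,56,61,27,76$; the cycles $1\,2\,7\,6$ and $1\,2\,3\,4\,5\,6$ are of Type 1. (e) Some reduct of $\widetilde G$ is switching equivalent to one of the following gain graphs, each obtained from the graph $K_{2,3}$ with vertices $1,\dots,5$ and edges $12,23,34,41,25,54$ by adding vertices and edges: - $\widetilde G_{18}$: add the vertex $6$ and the edge $56$;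 the cycle $1\,2\,3\,4$ is of Type 1; - $\widetilde G_{19}$: add the vertex $6$ and the edge $26$; any gains; - $\widetilde G_{20}$: add the vertices $6,7$ and the edges $26,47$; any gains; - $\widetilde G_{21}$: add the vertices $6,7$ and the edges $26,67$; the cycles $1\,2\,5\,4$ and $1\,2\,3\,4$ are of Type 1; - $\widetilde G_{22}$: add the vertices $6,7$ and the edges $56,67$; the cycles $1\,2\,5\,4$ and $1\,2\,3\,4$ are of Type 1. -/

import Mathlib

open scoped Quaternion

noncomputable section

/-- A quaternion unit gain graph on the vertex set `V`: an underlying simple graph and a gain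
`gain u v` of modulus one for every oriented edge `u v`, with `gain v u = (gain u v)⁻¹`.
The gain function is extended by `0` to the pairs of nonadjacent vertices. -/
@[ext]
structure QuatGainGraph (V : Type*) where
  graph : SimpleGraph V
  gain : V → V → ℍ[ℝ]
  norm_gain : ∀ u v, graph.Adj u v → ‖gain u v‖ = 1
  gain_symm : ∀ u v, graph.Adj u v → gain v u = (gain u v)⁻¹
  gain_eq_zero : ∀ u v, ¬ graph.Adj u v → gain u v = 0

namespace QuatGainGraph

variable {V W : Type*}

/-- The adjacency matrix. -/
def adjMatrix (G : QuatGainGraph V) : Matrix V V ℍ[ℝ] := Matrix.of G.gain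

/-- The left row rank of the adjacency matrix: the dimension of the left vector space spanned by
its rows. -/
def rank (G : QuatGainGraph V) : ℕ :=
  Module.finrank ℍ[ℝ] (Submodule.span ℍ[ℝ] (Set.range G.adjMatrix.row))

/-- The left row rank is the maximum number of rows that are left linearly independent. -/
theorem isGreatest_rank [Finite V] (G : QuatGainGraph V) :
    IsGreatest {k : ℕ | ∃ s : Finset V, s.card = k ∧ LinearIndepOn ℍ[ℝ] G.adjMatrix.row ↑s}
      G.rank := by
  classical
  have := Fintype.ofFinite V
  constructor
  · obtain ⟨κ, a, ha, hspan, hli⟩ := exists_linearIndependent' ℍ[ℝ] G.adjMatrix.row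
    have : Fintype κ := Fintype.ofInjective a ha
    refine ⟨Finset.univ.image a, ?_, ?_⟩
    · rw [Finset.card_image_of_injective _ ha, Finset.card_univ, rank, ← hspan,
        finrank_span_eq_card hli]
    · rw [Finset.coe_image, Finset.coe_univ, Set.image_univ, linearIndepOn_range_iff ha]
      exact hli
  · rintro k ⟨s, rfl, hs⟩
    have h := finrank_span_eq_card (show LinearIndependent ℍ[ℝ]
      (fun i : s => G.adjMatrix.row i) from hs)
    rw [Fintype.card_coe] at h
    rw [← h]
    apply Submodule.finrank_mono
    apply Submodule.span_mono
    rintro _ ⟨i, rfl⟩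
    exact ⟨i, rfl⟩

/-- The subgraph induced on `S`. -/
def induce (G : QuatGainGraph V) (S : Set V) : QuatGainGraph S where
  graph := G.graph.induce S
  gain u v := G.gain u v
  norm_gain u v h := G.norm_gain u v h
  gain_symm u v h := G.gain_symm u v h
  gain_eq_zero u v h := G.gain_eq_zero u v h

/-- Renaming the vertices along a bijection. -/
def relabel (G : QuatGainGraph V) (e : V ≃ W) : QuatGainGraph W where
  graph := G.graph.comap e.symm
  gain u v := G.gain (e.symm u) (e.symm v)
  norm_gain _ _ h := G.norm_gain _ _ h
  gain_symm _ _ h := G.gain_symm _ _ h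
  gain_eq_zero _ _ h := G.gain_eq_zero _ _ h

/-- `H` is obtained from `G` by switching: the underlying graph is the same, and the gains are
`ξ(u)⁻¹ φ(uv) ξ(v)` for some function `ξ` from the vertices to the unit quaternions. -/
def SwitchingEquivalent (G H : QuatGainGraph V) : Prop :=
  H.graph = G.graph ∧ ∃ ξ : V → ℍ[ℝ], (∀ v, ‖ξ v‖ = 1) ∧
    ∀ u v, H.gain u v = (ξ u)⁻¹ * G.gain u v * ξ v

/-- `x` and `y` are multiple vertices: they are distinct, have the same neighbours, and their rows
differ by a nonzero left factor. -/
def MultipleVertices (G : QuatGainGraph V) (x y : V) : Prop :=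
  x ≠ y ∧ G.graph.neighborSet x = G.graph.neighborSet y ∧
    ∃ k : ℍ[ℝ], k ≠ 0 ∧ ∀ z ∈ G.graph.neighborSet x, G.gain x z = k * G.gain y z

/-- `G.ReducesTo S`: the subgraph of `G` induced on `S` is obtained from `G` by successive (possibly
zero) reductions, each removing a vertex that has a multiple vertex in the current graph.
The reduced graph of `G` is a result of such a process that has no multiple vertices. -/
inductive ReducesTo (G : QuatGainGraph V) : Set V → Prop
  | univ : ReducesTo G Set.univ
  | step {S : Set V} (u v : S) (hS : ReducesTo G S) (huv : (G.induce S).MultipleVertices u v) :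
      ReducesTo G (S \ {(u : V)})

/-- Some result of successive reductions of `G` is, up to renaming the vertices, switching
equivalent to a gain graph in the class `P`. -/
def ReducesIntoClass (G : QuatGainGraph V) {n : ℕ} (P : QuatGainGraph (Fin n) → Prop) : Prop :=
  ∃ S : Set V, G.ReducesTo S ∧ ∃ (e : S ≃ Fin n) (K : QuatGainGraph (Fin n)),
    P K ∧ SwitchingEquivalent ((G.induce S).relabel e) K

/-! ### Gains and types of cycles -/

/-- The gain `φ(v₁v₂) φ(v₂v₃) ⋯ φ(vₙ₋₁vₙ) φ(vₙv₁)` of the closed walk `v₁ v₂ … vₙ v₁`. -/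
def cycleGain (G : QuatGainGraph V) (c : List V) : ℍ[ℝ] :=
  (List.zipWith G.gain c (c.rotate 1)).prod

/-- Type 1 cycles `v₁ v₂ … vₙ v₁`. -/
def IsType1 (G : QuatGainGraph V) (c : List V) : Prop :=
  Even c.length ∧ G.cycleGain c = (-1) ^ (c.length / 2)

/-- Type 2 cycles `v₁ v₂ … vₙ v₁`. -/
def IsType2 (G : QuatGainGraph V) (c : List V) : Prop :=
  Even c.length ∧ G.cycleGain c ≠ (-1) ^ (c.length / 2)

/-- Type 4 cycles `v₁ v₂ … vₙ v₁`. -/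
def IsType4 (G : QuatGainGraph V) (c : List V) : Prop :=
  Odd c.length ∧ ((-1) ^ ((c.length - 1) / 2) * G.cycleGain c).re = 0

/-! ### Attaching and joining stars -/

/-- `G` with a pendant star attached at `v`: the centre of a star with `p` leaves is identified
with `v`. -/
def attachStar (G : SimpleGraph V) (v : V) (p : ℕ) : SimpleGraph (V ⊕ Fin p) :=
  (G ⊕g (⊥ : SimpleGraph (Fin p))) ⊔
    SimpleGraph.fromRel fun x y => x = Sum.inl v ∧ ∃ i, y = Sum.inr i

/-- The disjoint union of `G` and a star with `q` leaves, with an edge added that joins `v` to the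
centre of the star. -/
def joinStar (G : SimpleGraph V) (v : V) (q : ℕ) : SimpleGraph (V ⊕ Fin (q + 1)) :=
  (G ⊕g SimpleGraph.starGraph (0 : Fin (q + 1))) ⊔ SimpleGraph.edge (Sum.inl v) (Sum.inr 0)

/-- `G` is a gain cycle `C₄` of Type 2. -/
def IsC4Type2 (G : QuatGainGraph V) : Prop :=
  ∃ e : SimpleGraph.cycleGraph 4 ≃g G.graph, G.IsType2 [e 0, e 1, e 2, e 3]

/-- `G` is a gain cycle `C₄` with a pendant star attached at exactly one vertex. -/
def IsC4OneStar (G : QuatGainGraph V) : Prop :=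
  ∃ (p : ℕ) (i : Fin 4), 1 ≤ p ∧
    Nonempty (attachStar (SimpleGraph.cycleGraph 4) i p ≃g G.graph)

/-- `G` is a gain cycle `C₄` with pendant stars attached at exactly two nonadjacent vertices. -/
def IsC4TwoStars (G : QuatGainGraph V) : Prop :=
  ∃ (p q : ℕ) (i j : Fin 4), 1 ≤ p ∧ 1 ≤ q ∧ i ≠ j ∧ ¬ (SimpleGraph.cycleGraph 4).Adj i j ∧
    Nonempty (attachStar (attachStar (SimpleGraph.cycleGraph 4) i p) (Sum.inl j) q ≃g G.graph)

/-- `G` is a gain cycle `C₄` of Type 1 together with a star with `q ≥ 1` leaves whose centre is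
joined by an edge to a vertex of the cycle. -/
def IsC4Type1JoinStar (G : QuatGainGraph V) : Prop :=
  ∃ (q : ℕ) (i : Fin 4), 1 ≤ q ∧
    ∃ e : joinStar (SimpleGraph.cycleGraph 4) i q ≃g G.graph,
      G.IsType1 [e (Sum.inl 0), e (Sum.inl 1), e (Sum.inl 2), e (Sum.inl 3)]

/-! ### Bicyclic gain graphs of rank four, with their gain conditions

The vertices `1, 2, …, n` of the usual labelling are the elements `0, 1, …, n - 1` of `Fin n`. -/

/-- Two 4-cycles with a common vertex, both of Type 1. -/
def IsTwoC4CommonVertex (K : QuatGainGraph (Fin 7)) : Prop :=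
  K.graph = SimpleGraph.fromEdgeSet
    {s(0, 1), s(1, 3), s(3, 2), s(2, 0), s(3, 4), s(4, 5), s(5, 6), s(6, 3)} ∧
  K.IsType1 [0, 1, 3, 2] ∧ K.IsType1 [3, 4, 5, 6]

/-- A 6-cycle with a chord joining opposite vertices. -/
def IsHexagonChord (K : QuatGainGraph (Fin 6)) : Prop :=
  K.graph = SimpleGraph.fromEdgeSet
    {s(0, 1), s(1, 2), s(2, 3), s(3, 4), s(4, 5), s(5, 0), s(1, 4)} ∧
  K.cycleGain [0, 1, 2, 3, 4, 5] - K.cycleGain [0, 1, 4, 5] + 1 = 0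

/-- The edges of `K_{2,3}`, with the parts `{1, 3}` and `{0, 2, 4}`. -/
def edgesK23 (n : ℕ) [NeZero n] : Set (Sym2 (Fin n)) :=
  {s(0, 1), s(1, 2), s(2, 3), s(3, 0), s(1, 4), s(4, 3)}

/-- `K_{2,3}`, with a 4-cycle of Type 2. -/
def IsTheta111 (K : QuatGainGraph (Fin 5)) : Prop :=
  K.graph = SimpleGraph.fromEdgeSet (edgesK23 5) ∧
  ((K.IsType1 [0, 1, 2, 3] ∧ K.IsType2 [0, 1, 4, 3]) ∨
    (K.IsType2 [0, 1, 2, 3] ∧ (K.IsType1 [0, 1, 4, 3] ∨ K.IsType2 [0, 1, 4, 3])))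

/-- Paths with 1, 1 and 2 inner vertices between two vertices. -/
def IsTheta112 (K : QuatGainGraph (Fin 6)) : Prop :=
  K.graph = SimpleGraph.fromEdgeSet
    {s(0, 1), s(1, 2), s(2, 3), s(3, 4), s(4, 0), s(1, 5), s(5, 4)} ∧
  K.IsType1 [0, 1, 5, 4] ∧ K.IsType4 [0, 1, 2, 3, 4]

/-- Paths with 1, 1 and 3 inner vertices between two vertices. -/
def IsTheta113 (K : QuatGainGraph (Fin 7)) : Prop :=
  K.graph = SimpleGraph.fromEdgeSet
    {s(0, 1), s(1, 2), s(2, 3), s(3, 4), s(4, 5), s(5, 0), s(1, 6), s(6, 5)} ∧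
  K.IsType1 [0, 1, 6, 5] ∧ K.IsType1 [0, 1, 2, 3, 4, 5]

/-- `K_{2,3}` with a pendant vertex at a vertex of degree 2, the 4-cycle that avoids this vertex
being of Type 1. -/
def IsK23PendantDegTwo (K : QuatGainGraph (Fin 6)) : Prop :=
  K.graph = SimpleGraph.fromEdgeSet (edgesK23 6 ∪ {s(4, 5)}) ∧ K.IsType1 [0, 1, 2, 3]

/-- `K_{2,3}` with a pendant vertex at a vertex of degree 3, any gain. -/
def IsK23PendantDegThree (K : QuatGainGraph (Fin 6)) : Prop :=
  K.graph = SimpleGraph.fromEdgeSet (edgesK23 6 ∪ {s(1, 5)})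

/-- `K_{2,3}` with a pendant vertex at each of the two vertices of degree 3, any gain. -/
def IsK23TwoPendants (K : QuatGainGraph (Fin 7)) : Prop :=
  K.graph = SimpleGraph.fromEdgeSet (edgesK23 7 ∪ {s(1, 5), s(3, 6)})

/-- `K_{2,3}` with all 4-cycles of Type 1 and a pendant path on two vertices joined to a vertex of
degree 3. -/
def IsK23PathDegThree (K : QuatGainGraph (Fin 7)) : Prop :=
  K.graph = SimpleGraph.fromEdgeSet (edgesK23 7 ∪ {s(1, 5), s(5, 6)}) ∧
  K.IsType1 [0, 1, 4, 3] ∧ K.IsType1 [0, 1, 2, 3]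

/-- `K_{2,3}` with all 4-cycles of Type 1 and a pendant path on two vertices joined to a vertex of
degree 2. -/
def IsK23PathDegTwo (K : QuatGainGraph (Fin 7)) : Prop :=
  K.graph = SimpleGraph.fromEdgeSet (edgesK23 7 ∪ {s(4, 5), s(5, 6)}) ∧
  K.IsType1 [0, 1, 4, 3] ∧ K.IsType1 [0, 1, 2, 3]

end QuatGainGraph

end

open scoped Quaternion

noncomputable section

namespace QuatGainGraph

variable {V W : Type*}

/-! The adjacency matrix is Hermitian, so a left proportionality between two rows is also a right
proportionality between the corresponding columns. Deleting a multiple vertex therefore loses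
neither a row direction nor column information, and switching only rescales rows and columns by
units. `rank_eq_of_map` covers both, together with renaming, so (d) and (e) reduce to rank
computations for ten small graphs.

For each graph, four rows are shown to form a basis of the row space. Usually they belong to two
edges `ab`, `cd` with `a` adjacent to neither `c` nor `d`; independence then needs no gain condition
(`rank_eq_four_of_two_edges`). The gain conditions only serve to express the remaining rows: Type 1
makes opposite rows of a 4-cycle proportional on the two columns they share (`IsType1.gain_eq`), and
the conditions on longer cycles cancel the one entry left over. For a Type 2 4-cycle the four cycle
rows are themselves independent (`rank_eq_four_of_isType2`). The cases with pendant stars follow by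
splitting off a pendant edge, which accounts for rank 2. -/

theorem star_gain (G : QuatGainGraph V) (u v : V) : star (G.gain u v) = G.gain v u := by
  by_cases h : G.graph.Adj u v
  · rw [G.gain_symm u v h]
    apply eq_inv_of_mul_eq_one_left
    rw [Quaternion.star_mul_self, Quaternion.normSq_eq_norm_mul_self, G.norm_gain u v h]
    simp
  · rw [G.gain_eq_zero u v h, G.gain_eq_zero v u fun h' => h h'.symm, star_zero]

theorem gain_mul_gain (G : QuatGainGraph V) {u v : V} (h : G.graph.Adj u v) :
    G.gain u v * G.gain v u = 1 := by
  rw [G.gain_symm u v h, mul_inv_cancel₀]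
  rw [← norm_ne_zero_iff, G.norm_gain u v h]
  exact one_ne_zero

theorem gain_mul_gain_mul (G : QuatGainGraph V) {u v : V} (h : G.graph.Adj u v) (x : ℍ[ℝ]) :
    G.gain u v * (G.gain v u * x) = x := by
  rw [← mul_assoc, G.gain_mul_gain h, one_mul]

theorem gain_ne_zero (G : QuatGainGraph V) {u v : V} (h : G.graph.Adj u v) : G.gain u v ≠ 0 :=
  left_ne_zero_of_mul (by rw [G.gain_mul_gain h]; exact one_ne_zero)

/-! ### Invariance of the rank under reduction, renaming and switching. -/

/-- The rank does not change when the vertices are pulled back along a map `σ` whose range contains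
a vertex with a proportional row for every vertex, and the rows and columns are rescaled. -/
theorem rank_eq_of_map [Finite V] [Finite W] (G : QuatGainGraph V) (H : QuatGainGraph W)
    (σ : W → V) (c d : W → ℍ[ℝ]) (hc : ∀ w, c w ≠ 0) (hd : ∀ w, d w ≠ 0)
    (hgain : ∀ w w', H.gain w w' = d w * G.gain (σ w) (σ w') * c w')
    (hσ : ∀ v, ∃ w k, ∀ z, G.gain v z = k * G.gain (σ w) z) : H.rank = G.rank := by
  -- Column scaling acts on the right, hence is left linear. This map carries the row space of `G`
  -- onto that of `H`; it remains to see that it is injective there.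
  let f : (V → ℍ[ℝ]) →ₗ[ℍ[ℝ]] (W → ℍ[ℝ]) :=
    { toFun := fun x w => x (σ w) * c w
      map_add' := fun x y => by ext1 w; simp [add_mul]
      map_smul' := fun a x => by ext1 w; simp [mul_assoc] }
  have hrow : ∀ w, H.adjMatrix.row w = d w • f (G.adjMatrix.row (σ w)) := fun w => by
    ext1 w'
    simp [f, adjMatrix, Matrix.row, hgain, mul_assoc]
  have hmap : (Submodule.span ℍ[ℝ] (Set.range G.adjMatrix.row)).map f =
      Submodule.span ℍ[ℝ] (Set.range H.adjMatrix.row) := by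
    apply le_antisymm
    · rw [Submodule.map_span_le]
      rintro _ ⟨v, rfl⟩
      obtain ⟨w, k, hk⟩ := hσ v
      have : f (G.adjMatrix.row v) = (k * (d w)⁻¹) • H.adjMatrix.row w := by
        rw [hrow, smul_smul, mul_assoc, inv_mul_cancel₀ (hd w), mul_one, ← map_smul]
        congr 1
        ext1 z
        exact hk z
      rw [this]
      exact Submodule.smul_mem _ _ (Submodule.subset_span ⟨w, rfl⟩)
    · rw [Submodule.span_le]
      rintro _ ⟨w, rfl⟩
      rw [hrow]
      exact Submodule.smul_mem _ _ (Submodule.mem_map_of_mem (Submodule.subset_span ⟨σ w, rfl⟩))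
  -- Hermitian symmetry turns the row relation into a column relation, which every vector of the row
  -- space inherits. Such a vector is thus determined by its entries on the range of `σ`.
  have hcol : ∀ v w k, (∀ z, G.gain v z = k * G.gain (σ w) z) →
      ∀ x ∈ Submodule.span ℍ[ℝ] (Set.range G.adjMatrix.row), x v = x (σ w) * star k := by
    intro v w k hk x hx
    induction hx using Submodule.span_induction with
    | mem x hx =>
      obtain ⟨z, rfl⟩ := hx
      have := congrArg star (hk z)
      rwa [star_mul, star_gain, star_gain] at this
    | zero => simp
    | add x y _ _ hx hy => simp [hx, hy, add_mul]
    | smul a x _ hx => simp [hx, mul_assoc]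
  have hinj : Function.Injective
      (f.domRestrict (Submodule.span ℍ[ℝ] (Set.range G.adjMatrix.row))) := by
    rw [← LinearMap.ker_eq_bot, LinearMap.ker_eq_bot']
    rintro ⟨x, hx⟩ hfx
    ext1
    ext1 v
    obtain ⟨w, k, hk⟩ := hσ v
    have h0 : x (σ w) * c w = 0 := congrFun hfx w
    rw [mul_eq_zero, or_iff_left (hc w)] at h0
    simp [hcol v w k hk x hx, h0]
  rw [rank, rank, ← hmap, ← LinearMap.range_domRestrict, LinearMap.finrank_range_of_inj hinj]

theorem ReducesTo.rank_eq [Finite V] {G : QuatGainGraph V} {S : Set V} (h : G.ReducesTo S) :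
    (G.induce S).rank = G.rank := by
  induction h with
  | univ =>
    exact rank_eq_of_map G _ Subtype.val 1 1 (by simp) (by simp) (by simp [induce])
      fun v => ⟨⟨v, trivial⟩, 1, by simp⟩
  | @step S u v _ huv ih =>
    obtain ⟨hne, hN, k, -, hk⟩ := huv
    rw [← ih]
    refine rank_eq_of_map (G.induce S) _ (fun w => ⟨w, w.2.1⟩) 1 1 (by simp) (by simp)
      (by simp [induce]) fun z => ?_
    by_cases hz : z = u
    -- The deleted vertex is represented by its surviving multiple vertex; every other vertex
    -- represents itself.
    · refine ⟨⟨v, v.2, fun h => hne (Subtype.ext h).symm⟩, k, fun w => ?_⟩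
      subst hz
      by_cases hw : (G.induce S).graph.Adj z w
      · exact hk w hw
      · have hw' : ¬ (G.induce S).graph.Adj v w := fun h => hw ((Set.ext_iff.mp hN w).mpr h)
        rw [gain_eq_zero _ _ _ hw]
        change 0 = k * (G.induce S).gain v w
        rw [gain_eq_zero _ _ _ hw', mul_zero]
    · exact ⟨⟨z, z.2, fun h => hz (Subtype.ext h)⟩, 1, by simp⟩

theorem rank_relabel [Finite V] [Finite W] (G : QuatGainGraph V) (e : V ≃ W) :
    (G.relabel e).rank = G.rank :=
  rank_eq_of_map G _ e.symm 1 1 (by simp) (by simp) (by simp [relabel])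
    fun v => ⟨e v, 1, by simp⟩

theorem SwitchingEquivalent.rank_eq [Finite V] {G H : QuatGainGraph V}
    (h : G.SwitchingEquivalent H) : H.rank = G.rank := by
  obtain ⟨-, ξ, hξ, h⟩ := h
  have hξ0 : ∀ v, ξ v ≠ 0 := fun v => by rw [← norm_ne_zero_iff, hξ]; exact one_ne_zero
  exact rank_eq_of_map G H id ξ (fun v => (ξ v)⁻¹) hξ0 (fun v => inv_ne_zero (hξ0 v)) h
    fun v => ⟨v, 1, by simp⟩

theorem ReducesIntoClass.rank_eq [Finite V] {G : QuatGainGraph V} {n r : ℕ}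
    {P : QuatGainGraph (Fin n) → Prop} (h : G.ReducesIntoClass P) (hP : ∀ K, P K → K.rank = r) :
    G.rank = r := by
  obtain ⟨S, hS, e, K, hK, hsw⟩ := h
  rw [← hS.rank_eq, ← rank_relabel _ e, ← hsw.rank_eq, hP K hK]

/-! ### Four rows forming a basis of the row space. -/

theorem rank_eq_card {ι : Type*} [Fintype ι] (G : QuatGainGraph V) (u : ι → V)
    (hli : LinearIndependent ℍ[ℝ] (G.adjMatrix.row ∘ u))
    (hspan : ∀ v, G.adjMatrix.row v ∈ Submodule.span ℍ[ℝ] (Set.range (G.adjMatrix.row ∘ u))) :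
    G.rank = Fintype.card ι := by
  rw [rank, ← finrank_span_eq_card hli]
  have : Submodule.span ℍ[ℝ] (Set.range G.adjMatrix.row) =
      Submodule.span ℍ[ℝ] (Set.range (G.adjMatrix.row ∘ u)) := by
    apply le_antisymm
    · rw [Submodule.span_le]
      rintro _ ⟨v, rfl⟩
      exact hspan v
    · exact Submodule.span_mono (Set.range_comp_subset_range _ _)
  rw [this]

/-- Every row is one of the rows of `a`, `b`, `c`, `d` or a left linear combination of them. -/
def RowsSpannedBy (G : QuatGainGraph V) (a b c d : V) : Prop :=
  ∀ v, v = a ∨ v = b ∨ v = c ∨ v = d ∨ ∃ p q r s : ℍ[ℝ], ∀ w,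
    G.gain v w = p * G.gain a w + q * G.gain b w + r * G.gain c w + s * G.gain d w

theorem rank_eq_four {G : QuatGainGraph V} {a b c d : V}
    (hli : ∀ p q r s : ℍ[ℝ], (∀ w, p * G.gain a w + q * G.gain b w + r * G.gain c w +
      s * G.gain d w = 0) → p = 0 ∧ q = 0 ∧ r = 0 ∧ s = 0)
    (hspan : G.RowsSpannedBy a b c d) : G.rank = 4 := by
  refine (rank_eq_card G ![a, b, c, d] ?_ fun v => ?_).trans (Fintype.card_fin 4)
  · rw [Fintype.linearIndependent_iff]
    intro g hg
    obtain ⟨h0, h1, h2, h3⟩ := hli (g 0) (g 1) (g 2) (g 3) fun w => by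
      have := congrFun hg w
      rw [Fin.sum_univ_four] at this
      exact this
    intro i
    fin_cases i <;> assumption
  · have hmem : ∀ i, G.adjMatrix.row (![a, b, c, d] i) ∈
        Submodule.span ℍ[ℝ] (Set.range (G.adjMatrix.row ∘ ![a, b, c, d])) :=
      fun i => Submodule.subset_span ⟨i, rfl⟩
    rcases hspan v with rfl | rfl | rfl | rfl | ⟨p, q, r, s, h⟩
    · exact hmem 0
    · exact hmem 1
    · exact hmem 2
    · exact hmem 3
    · have : G.adjMatrix.row v = p • G.adjMatrix.row a + q • G.adjMatrix.row b +
          r • G.adjMatrix.row c + s • G.adjMatrix.row d := by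
        ext1 w
        exact h w
      rw [this]
      exact add_mem (add_mem (add_mem (Submodule.smul_mem _ _ (hmem 0))
        (Submodule.smul_mem _ _ (hmem 1))) (Submodule.smul_mem _ _ (hmem 2)))
        (Submodule.smul_mem _ _ (hmem 3))

/-- Read in the columns `a`, `c`, `d`, `b`, in this order, the system is triangular: each column
isolates one new coefficient. Edges from `b` to `c` or `d` do no harm, since the coefficient of row
`b` is eliminated at once. -/
theorem rank_eq_four_of_two_edges {G : QuatGainGraph V} {a b c d : V} (hab : G.graph.Adj a b)
    (hcd : G.graph.Adj c d) (hac : ¬ G.graph.Adj a c) (had : ¬ G.graph.Adj a d)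
    (hspan : G.RowsSpannedBy a b c d) : G.rank = 4 := by
  refine rank_eq_four (fun p q r s h => ?_) hspan
  have hq : q = 0 := by
    simpa [G.gain_eq_zero a a G.graph.irrefl, G.gain_eq_zero c a fun h => hac h.symm,
      G.gain_eq_zero d a fun h => had h.symm, G.gain_ne_zero hab.symm] using h a
  have hs : s = 0 := by
    simpa [hq, G.gain_eq_zero a c hac, G.gain_eq_zero c c G.graph.irrefl,
      G.gain_ne_zero hcd.symm] using h c
  have hr : r = 0 := by
    simpa [hq, hs, G.gain_eq_zero a d had, G.gain_ne_zero hcd] using h d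
  have hp : p = 0 := by
    simpa [hq, hs, hr, G.gain_ne_zero hab] using h b
  exact ⟨hp, hq, hr, hs⟩

/-! ### Rows of 4-cycles of Types 1 and 2. -/

theorem isType1_four (G : QuatGainGraph V) (a b c d : V) :
    G.IsType1 [a, b, c, d] ↔ G.gain a b * G.gain b c * G.gain c d * G.gain d a = 1 := by
  simp [IsType1, cycleGain, mul_assoc, show Even 4 by decide]

theorem isType2_four (G : QuatGainGraph V) (a b c d : V) :
    G.IsType2 [a, b, c, d] ↔ G.gain a b * G.gain b c * G.gain c d * G.gain d a ≠ 1 := by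
  simp [IsType2, cycleGain, mul_assoc, show Even 4 by decide]

theorem IsType1.rotate {G : QuatGainGraph V} {a b c d : V} (h : G.IsType1 [a, b, c, d]) :
    G.IsType1 [b, c, d, a] := by
  rw [isType1_four] at h ⊢
  simp only [mul_assoc] at h ⊢
  simpa only [mul_assoc] using mul_eq_one_symm h

/-- Conjugation reverses a product of gains and fixes 1. -/
theorem IsType1.reverse {G : QuatGainGraph V} {a b c d : V} (h : G.IsType1 [a, b, c, d]) :
    G.IsType1 [d, c, b, a] := by
  apply IsType1.rotate
  rw [isType1_four] at h ⊢
  have := congrArg star h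
  simpa only [star_mul, star_gain, star_one, mul_assoc] using this

/-- The use is that row `c` equals `G.gain c b * G.gain b a` times row `a` in the columns `b` and
`d`: column `b` is automatic, and this is column `d`. -/
theorem IsType1.gain_eq {G : QuatGainGraph V} {a b c d : V} (h : G.IsType1 [a, b, c, d])
    (hab : G.graph.Adj a b) (hbc : G.graph.Adj b c) (hda : G.graph.Adj d a) :
    G.gain c d = G.gain c b * (G.gain b a * G.gain a d) := by
  rw [isType1_four] at h
  calc G.gain c d = G.gain c b * (G.gain b a * (G.gain a b * G.gain b c * G.gain c d *
        G.gain d a * G.gain a d)) := by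
        simp only [mul_assoc, G.gain_mul_gain hda, mul_one, G.gain_mul_gain_mul hab.symm,
          G.gain_mul_gain_mul hbc.symm]
    _ = _ := by rw [h, one_mul]

/-- A 4-cycle of Type 2 in which opposite vertices are not adjacent has rank 4. -/
theorem rank_eq_four_of_isType2 {G : QuatGainGraph V} {a b c d : V} (hab : G.graph.Adj a b)
    (hbc : G.graph.Adj b c) (hcd : G.graph.Adj c d) (hda : G.graph.Adj d a)
    (hac : ¬ G.graph.Adj a c) (hbd : ¬ G.graph.Adj b d) (h2 : G.IsType2 [a, b, c, d])
    (hspan : G.RowsSpannedBy a b c d) : G.rank = 4 := by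
  rw [isType2_four] at h2
  -- On the cycle the matrix splits into two 2×2 blocks, rows `a`, `c` against columns `b`, `d` and
  -- conversely. Eliminating one unknown shows that the other, up to a unit, is fixed by right
  -- multiplication by the cycle gain, so it vanishes.
  have key : ∀ x y : ℍ[ℝ], x * G.gain a b + y * G.gain c b = 0 →
      x * G.gain a d + y * G.gain c d = 0 → x = 0 ∧ y = 0 := by
    intro x y h1 h3
    have h4 : x * G.gain a b * G.gain b c = -y := by
      rw [eq_neg_of_add_eq_zero_left h1, neg_mul, mul_assoc, G.gain_mul_gain hbc.symm, mul_one]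
    have h5 : x * G.gain a d = -(y * G.gain c d) := eq_neg_of_add_eq_zero_left h3
    have h6 : x * (G.gain a b * G.gain b c * G.gain c d * G.gain d a) = x := by
      rw [← mul_assoc, ← mul_assoc, ← mul_assoc, h4, neg_mul, ← h5, mul_assoc,
        G.gain_mul_gain hda.symm, mul_one]
    have hx : x = 0 := by
      by_contra hx
      exact h2 (mul_left_cancel₀ hx (h6.trans (mul_one x).symm))
    refine ⟨hx, ?_⟩
    rw [hx, zero_mul, zero_mul, zero_eq_neg] at h4
    exact h4
  have key' : ∀ x y : ℍ[ℝ], x * G.gain b a + y * G.gain d a = 0 →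
      x * G.gain b c + y * G.gain d c = 0 → x = 0 ∧ y = 0 := by
    intro x y h1 h3
    have h4 : x = -(y * G.gain d a * G.gain a b) := by
      rw [← neg_mul, ← eq_neg_of_add_eq_zero_left h1, mul_assoc, G.gain_mul_gain hab.symm, mul_one]
    have h5 : x * G.gain b c = -(y * G.gain d c) := eq_neg_of_add_eq_zero_left h3
    have h6 : y * G.gain d a * (G.gain a b * G.gain b c * G.gain c d * G.gain d a) =
        y * G.gain d a := by
      have h7 : y * G.gain d a * G.gain a b * G.gain b c = y * G.gain d c := by
        rw [← neg_inj, ← h5, h4, neg_mul]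
      rw [← mul_assoc, ← mul_assoc, ← mul_assoc, h7, mul_assoc y, G.gain_mul_gain hcd.symm, mul_one]
    have hy : y = 0 := by
      by_contra hy
      exact h2 (mul_left_cancel₀ (mul_ne_zero hy (G.gain_ne_zero hda)) (h6.trans (mul_one _).symm))
    simp [h4, hy]
  refine rank_eq_four (fun p q r s h => ?_) hspan
  have hirr := fun v => G.gain_eq_zero v v G.graph.irrefl
  have hac' := G.gain_eq_zero _ _ hac
  have hca' := G.gain_eq_zero c a fun h => hac h.symm
  have hbd' := G.gain_eq_zero _ _ hbd
  have hdb' := G.gain_eq_zero d b fun h => hbd h.symm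
  obtain ⟨hp, hr⟩ := key p r (by simpa [hirr, hdb'] using h b) (by simpa [hirr, hbd'] using h d)
  obtain ⟨hq, hs⟩ := key' q s (by simpa [hirr, hca'] using h a) (by simpa [hirr, hac'] using h c)
  exact ⟨hp, hq, hr, hs⟩

/-- Rows `a` and `c`, cut down to the columns `b` and `d`, span the whole plane. Eliminating `x`
leaves `y * D = s * G.gain b a - t * G.gain d a`, and `D = 0` would make the cycle gain 1. -/
theorem IsType2.exists_row_eq {G : QuatGainGraph V} {a b c d : V} (h : G.IsType2 [a, b, c, d])
    (hab : G.graph.Adj a b) (hbc : G.graph.Adj b c) (hda : G.graph.Adj d a) (s t : ℍ[ℝ]) : ∃ x y : ℍ[ℝ],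
      s = x * G.gain a b + y * G.gain c b ∧ t = x * G.gain a d + y * G.gain c d := by
  rw [isType2_four] at h
  set D := G.gain c b * G.gain b a - G.gain c d * G.gain d a with hD
  have hD0 : D ≠ 0 := by
    intro h0
    apply h
    rw [mul_assoc (_ * _), ← sub_eq_zero.1 h0]
    simp only [mul_assoc, G.gain_mul_gain_mul hbc, G.gain_mul_gain hab]
  have hy : (s * G.gain b a - t * G.gain d a) * D⁻¹ * D = s * G.gain b a - t * G.gain d a := by
    rw [mul_assoc, inv_mul_cancel₀ hD0, mul_one]
  generalize (s * G.gain b a - t * G.gain d a) * D⁻¹ = y at hy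
  refine ⟨s * G.gain b a - y * G.gain c b * G.gain b a, y, ?_, ?_⟩
  · simp only [sub_mul, mul_assoc, G.gain_mul_gain hab.symm, mul_one]
    abel
  · have : s * G.gain b a - y * G.gain c b * G.gain b a =
        t * G.gain d a - y * G.gain c d * G.gain d a := by
      rw [hD, mul_sub, sub_eq_sub_iff_add_eq_add] at hy
      rw [sub_eq_sub_iff_add_eq_add, mul_assoc, mul_assoc, ← hy, add_comm]
    rw [this]
    simp only [sub_mul, mul_assoc, G.gain_mul_gain hda, mul_one]
    abel

/-! ### Splitting off a pendant edge. -/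

/-- A pendant vertex `a` at `b`, and two adjacent vertices `c`, `d` whose rows span the other rows
off the column of `b`. -/
theorem rank_eq_four_of_pendant {G : QuatGainGraph V} {a b c d : V} (hab : G.graph.Adj a b)
    (ha : ∀ w, G.graph.Adj a w → w = b) (hcd : G.graph.Adj c d) (hcb : c ≠ b) (hdb : d ≠ b)
    (hspan : ∀ v, v = b ∨ ∃ r s : ℍ[ℝ], ∀ w, w ≠ b →
      G.gain v w = r * G.gain c w + s * G.gain d w) : G.rank = 4 := by
  refine rank_eq_four_of_two_edges hab hcd (fun h => hcb (ha _ h)) (fun h => hdb (ha _ h))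
    fun v => ?_
  rcases hspan v with rfl | ⟨r, s, h⟩
  · tauto
  -- Row `a` is supported at column `b` alone, so a multiple of it repairs that column without
  -- touching the others.
  refine Or.inr (Or.inr (Or.inr (Or.inr ⟨(G.gain v b - r * G.gain c b - s * G.gain d b) *
    G.gain b a, 0, r, s, fun w => ?_⟩)))
  by_cases hw : w = b
  · subst hw
    rw [mul_assoc, G.gain_mul_gain hab.symm]
    noncomm_ring
  · rw [h w hw, G.gain_eq_zero a w fun h' => hw (ha w h')]
    simp

/-- A pendant vertex `a` at `b`, and a vertex `c` that is pendant at `d` once `b` is removed, such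
that every edge meets `{b, d}`. -/
theorem rank_eq_four_of_edges_meet {G : QuatGainGraph V} {a b c d : V} (hab : G.graph.Adj a b)
    (ha : ∀ w, G.graph.Adj a w → w = b) (hcd : G.graph.Adj c d) (hcb : c ≠ b) (hdb : d ≠ b)
    (hc : ∀ w, G.graph.Adj c w → w = b ∨ w = d)
    (hcover : ∀ v w, G.graph.Adj v w → v = b ∨ v = d ∨ w = b ∨ w = d) : G.rank = 4 := by
  refine rank_eq_four_of_pendant hab ha hcd hcb hdb fun v => ?_
  by_cases hvb : v = b
  · exact Or.inl hvb
  by_cases hvd : v = d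
  · exact Or.inr ⟨0, 1, fun w _ => by simp [hvd]⟩
  -- Off the column of `b`, rows `v` and `c` both live in column `d` only.
  refine Or.inr ⟨G.gain v d * G.gain d c, 0, fun w hw => ?_⟩
  by_cases hwd : w = d
  · rw [hwd, mul_assoc, G.gain_mul_gain hcd.symm]
    simp
  · rw [G.gain_eq_zero c w fun h => (hc w h).elim hw hwd, G.gain_eq_zero v w fun h =>
      (hcover v w h).elim hvb fun h => h.elim hvd fun h => h.elim hw hwd]
    simp

/-! ### Bicyclic graphs with an explicit edge list. -/

/-- Adjacency in the graph on `Fin n` with the listed edges, as a Boolean. -/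
def listAdj {n : ℕ} (L : List (Fin n × Fin n)) (u v : Fin n) : Bool :=
  L.contains (u, v) || L.contains (v, u)

/-- The edges of the underlying graph are the listed ones. -/
def HasEdges {n : ℕ} (K : QuatGainGraph (Fin n)) (L : List (Fin n × Fin n)) : Prop :=
  ∀ u v, K.graph.Adj u v ↔ listAdj L u v = true

namespace HasEdges

variable {n : ℕ} {K : QuatGainGraph (Fin n)} {L : List (Fin n × Fin n)} {u v : Fin n}

theorem adj (hK : K.HasEdges L) (h : listAdj L u v = true) : K.graph.Adj u v :=
  (hK u v).2 h

theorem not_adj (hK : K.HasEdges L) (h : listAdj L u v = false) : ¬ K.graph.Adj u v :=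
  fun h' => Bool.false_ne_true (h.symm.trans ((hK u v).1 h'))

theorem gain_eq_zero (hK : K.HasEdges L) (h : listAdj L u v = false) : K.gain u v = 0 :=
  K.gain_eq_zero u v (hK.not_adj h)

theorem gain_mul_gain (hK : K.HasEdges L) (h : listAdj L u v = true) :
    K.gain u v * K.gain v u = 1 :=
  K.gain_mul_gain (hK.adj h)

theorem gain_mul_gain_mul (hK : K.HasEdges L) (h : listAdj L u v = true) (x : ℍ[ℝ]) :
    K.gain u v * (K.gain v u * x) = x :=
  K.gain_mul_gain_mul (hK.adj h) x

end HasEdges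

theorem mul_eq_neg_one_symm {x y : ℍ[ℝ]} (h : x * y = -1) : y * x = -1 := by
  have h' : -x * y = 1 := by rw [neg_mul, h, neg_neg]
  have := mul_eq_one_symm h'
  rwa [mul_neg, neg_eq_iff_eq_neg] at this

theorem IsTwoC4CommonVertex.rank_eq {K : QuatGainGraph (Fin 7)} (h : K.IsTwoC4CommonVertex) :
    K.rank = 4 := by
  obtain ⟨hG, h1, h2⟩ := h
  -- With Boolean adjacency, each edge and non-edge needed below is settled by evaluation.
  have hK : K.HasEdges
      [(0, 1), (1, 3), (3, 2), (2, 0), (3, 4), (4, 5), (5, 6), (6, 3)] := by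
    simp only [HasEdges, hG, SimpleGraph.fromEdgeSet_adj, Set.mem_insert_iff,
      Set.mem_singleton_iff]
    decide
  have e1 := h1.reverse.rotate.rotate.gain_eq (hK.adj rfl) (hK.adj rfl) (hK.adj rfl)
  have e2 := h2.rotate.gain_eq (hK.adj rfl) (hK.adj rfl) (hK.adj rfl)
  have e3 := h1.gain_eq (hK.adj rfl) (hK.adj rfl) (hK.adj rfl)
  have e4 := h2.reverse.rotate.gain_eq (hK.adj rfl) (hK.adj rfl) (hK.adj rfl)
  refine rank_eq_four_of_two_edges (a := 0) (b := 1) (c := 5) (d := 4) (hK.adj rfl)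
    (hK.adj rfl) (hK.not_adj rfl) (hK.not_adj rfl) fun v => ?_
  fin_cases v
  · tauto
  · tauto
  · refine Or.inr <| Or.inr <| Or.inr <| Or.inr
      ⟨0, K.gain 2 0 * K.gain 0 1, 0, 0, fun w => ?_⟩
    fin_cases w <;> simp (decide := true) [hK.gain_eq_zero, hK.gain_mul_gain,
      mul_assoc, e1]
  -- The neighbours of the common vertex split into those of 0 and those of 5, its opposites in the
  -- two cycles; Type 1 matches each half.
  · refine Or.inr <| Or.inr <| Or.inr <| Or.inr
      ⟨K.gain 3 1 * K.gain 1 0, 0, K.gain 3 4 * K.gain 4 5, 0, fun w => ?_⟩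
    fin_cases w <;> simp (decide := true) [hK.gain_eq_zero, hK.gain_mul_gain,
      mul_assoc, e3, e4]
  · tauto
  · tauto
  · refine Or.inr <| Or.inr <| Or.inr <| Or.inr
      ⟨0, 0, 0, K.gain 6 5 * K.gain 5 4, fun w => ?_⟩
    fin_cases w <;> simp (decide := true) [hK.gain_eq_zero, hK.gain_mul_gain,
      mul_assoc, e2]

theorem IsTheta113.rank_eq {K : QuatGainGraph (Fin 7)} (h : K.IsTheta113) :
    K.rank = 4 := by
  obtain ⟨hG, h1, h2⟩ := h
  have hK : K.HasEdges
      [(0, 1), (1, 2), (2, 3), (3, 4), (4, 5), (5, 0), (1, 6), (6, 5)] := by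
    simp only [HasEdges, hG, SimpleGraph.fromEdgeSet_adj, Set.mem_insert_iff,
      Set.mem_singleton_iff]
    decide
  have e1 := h1.gain_eq (hK.adj rfl) (hK.adj rfl) (hK.adj rfl)
  have e2 := h1.reverse.rotate.rotate.gain_eq (hK.adj rfl) (hK.adj rfl) (hK.adj rfl)
  have hgain : K.gain 0 1 * (K.gain 1 2 * (K.gain 2 3 * (K.gain 3 4 *
      (K.gain 4 5 * K.gain 5 0)))) = -1 := by
    simpa [cycleGain, mul_assoc, Odd.neg_one_pow (show Odd 3 by decide)] using h2.2
  -- Row 4 is sought from rows 0 and 2. Columns 5 and 3 fix the coefficients, and the superfluous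
  -- entries in column 1 must cancel, which they do because the hexagon has gain -1.
  have hrow4 : K.gain 4 5 * (K.gain 5 0 * K.gain 0 1) +
      K.gain 4 3 * (K.gain 3 2 * K.gain 2 1) = 0 := by
    have h := mul_eq_neg_one_symm hgain
    simp only [mul_assoc] at h
    have h' : K.gain 4 5 * (K.gain 5 0 * K.gain 0 1) = K.gain 4 3 * (K.gain 3 2 * (K.gain 2 1 *
        (K.gain 1 2 * (K.gain 2 3 * (K.gain 3 4 * (K.gain 4 5 * (K.gain 5 0 * K.gain 0 1))))))) := by
      simp (decide := true) only [hK.gain_mul_gain_mul]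
    rw [h', h]
    simp
  -- Row 5 is sought from rows 1 and 3: columns 0 and 2 fix the coefficients, and this is column 4.
  have hrow5 : K.gain 5 4 = -(K.gain 5 0 * (K.gain 0 1 * (K.gain 1 2 *
      (K.gain 2 3 * K.gain 3 4)))) := by
    have h : K.gain 5 0 * (K.gain 0 1 * (K.gain 1 2 * (K.gain 2 3 * K.gain 3 4))) =
        K.gain 5 0 * (K.gain 0 1 * (K.gain 1 2 * (K.gain 2 3 * (K.gain 3 4 *
        (K.gain 4 5 * K.gain 5 0)))) * (K.gain 0 5 * K.gain 5 4)) := by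
      simp (decide := true) only [mul_assoc, hK.gain_mul_gain_mul, hK.gain_mul_gain, mul_one]
    rw [h, hgain]
    simp (decide := true) [hK.gain_mul_gain_mul]
  refine rank_eq_four_of_two_edges (a := 0) (b := 1) (c := 2) (d := 3) (hK.adj rfl)
    (hK.adj rfl) (hK.not_adj rfl) (hK.not_adj rfl) fun v => ?_
  fin_cases v
  · tauto
  · tauto
  · tauto
  · tauto
  · refine Or.inr <| Or.inr <| Or.inr <| Or.inr
      ⟨K.gain 4 5 * K.gain 5 0, 0, K.gain 4 3 * K.gain 3 2, 0, fun w => ?_⟩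
    fin_cases w <;> simp (decide := true) [hK.gain_eq_zero, hK.gain_mul_gain,
      mul_assoc, hrow4]
  · refine Or.inr <| Or.inr <| Or.inr <| Or.inr
      ⟨0, K.gain 5 0 * K.gain 0 1, 0, -(K.gain 5 0 * K.gain 0 1 * K.gain 1 2 * K.gain 2 3), fun w => ?_⟩
    fin_cases w <;> simp (decide := true) [hK.gain_eq_zero, hK.gain_mul_gain,
      mul_assoc, hrow5, e2]
  · refine Or.inr <| Or.inr <| Or.inr <| Or.inr
      ⟨K.gain 6 1 * K.gain 1 0, 0, 0, 0, fun w => ?_⟩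
    fin_cases w <;> simp (decide := true) [hK.gain_eq_zero, hK.gain_mul_gain,
      mul_assoc, e1]

theorem IsTheta112.rank_eq {K : QuatGainGraph (Fin 6)} (h : K.IsTheta112) :
    K.rank = 4 := by
  obtain ⟨hG, h1, h2⟩ := h
  have hK : K.HasEdges
      [(0, 1), (1, 2), (2, 3), (3, 4), (4, 0), (1, 5), (5, 4)] := by
    simp only [HasEdges, hG, SimpleGraph.fromEdgeSet_adj, Set.mem_insert_iff,
      Set.mem_singleton_iff]
    decide
  have e1 := h1.gain_eq (hK.adj rfl) (hK.adj rfl) (hK.adj rfl)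
  have e2 := h1.reverse.rotate.rotate.gain_eq (hK.adj rfl) (hK.adj rfl) (hK.adj rfl)
  have hre : (K.gain 0 1 * (K.gain 1 2 * (K.gain 2 3 * (K.gain 3 4 * K.gain 4 0)))).re = 0 := by
    simpa [cycleGain, mul_assoc] using h2.2
  -- A quaternion with zero real part is the negative of its conjugate, here the gain of the
  -- reversed 5-cycle.
  have hstar : K.gain 0 4 * (K.gain 4 3 * (K.gain 3 2 * (K.gain 2 1 * K.gain 1 0))) +
      K.gain 0 1 * (K.gain 1 2 * (K.gain 2 3 * (K.gain 3 4 * K.gain 4 0))) = 0 := by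
    have h := Quaternion.star_add_self
      (K.gain 0 1 * (K.gain 1 2 * (K.gain 2 3 * (K.gain 3 4 * K.gain 4 0))))
    rw [hre] at h
    simpa [star_gain, mul_assoc] using h
  -- The cycle being odd, row 4 needs all four basis rows. Columns 0, 1, 2, 3 determine the
  -- coefficients, and the diagonal entry in column 4 vanishes exactly by the Type 4 condition,
  -- based at 4 instead of 0.
  have hrow4 : -(K.gain 4 3 * (K.gain 3 2 * (K.gain 2 1 * (K.gain 1 0 * K.gain 0 4)))) +
      -(K.gain 4 0 * (K.gain 0 1 * (K.gain 1 2 * (K.gain 2 3 * K.gain 3 4)))) = 0 := by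
    have h := congrArg (fun x => K.gain 4 0 * x * K.gain 0 4) hstar
    simp (decide := true) only [mul_add, add_mul, mul_assoc, hK.gain_mul_gain_mul,
      hK.gain_mul_gain, mul_one, zero_mul, mul_zero] at h
    rw [← neg_add, h, neg_zero]
  refine rank_eq_four_of_two_edges (a := 0) (b := 1) (c := 2) (d := 3) (hK.adj rfl)
    (hK.adj rfl) (hK.not_adj rfl) (hK.not_adj rfl) fun v => ?_
  fin_cases v
  · tauto
  · tauto
  · tauto
  · tauto
  · refine Or.inr <| Or.inr <| Or.inr <| Or.inr
      ⟨-(K.gain 4 3 * K.gain 3 2 * K.gain 2 1 * K.gain 1 0), K.gain 4 0 * K.gain 0 1, K.gain 4 3 * K.gain 3 2, -(K.gain 4 0 * K.gain 0 1 * K.gain 1 2 * K.gain 2 3), fun w => ?_⟩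
    fin_cases w <;> simp (decide := true) [hK.gain_eq_zero, hK.gain_mul_gain,
      mul_assoc, e2, hrow4]
  · refine Or.inr <| Or.inr <| Or.inr <| Or.inr
      ⟨K.gain 5 1 * K.gain 1 0, 0, 0, 0, fun w => ?_⟩
    fin_cases w <;> simp (decide := true) [hK.gain_eq_zero, hK.gain_mul_gain,
      mul_assoc, e1]

theorem IsHexagonChord.rank_eq {K : QuatGainGraph (Fin 6)} (h : K.IsHexagonChord) :
    K.rank = 4 := by
  obtain ⟨hG, h1⟩ := h
  have hK : K.HasEdges
      [(0, 1), (1, 2), (2, 3), (3, 4), (4, 5), (5, 0), (1, 4)] := by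
    simp only [HasEdges, hG, SimpleGraph.fromEdgeSet_adj, Set.mem_insert_iff,
      Set.mem_singleton_iff]
    decide
  have hP : K.gain 0 1 * (K.gain 1 4 * (K.gain 4 5 * K.gain 5 0)) = K.gain 0 1 * (K.gain 1 2 *
      (K.gain 2 3 * (K.gain 3 4 * (K.gain 4 5 * K.gain 5 0)))) + 1 := by
    rw [eq_comm, ← sub_eq_zero, ← h1]
    simp only [cycleGain, List.rotate_cons_succ, List.rotate_zero, List.cons_append,
      List.nil_append, List.zipWith_cons_cons, List.zipWith_nil_left, List.prod_cons,
      List.prod_nil, mul_one]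
    abel
  have hP' : K.gain 0 5 * (K.gain 5 4 * (K.gain 4 1 * K.gain 1 0)) = K.gain 0 5 * (K.gain 5 4 *
      (K.gain 4 3 * (K.gain 3 2 * (K.gain 2 1 * K.gain 1 0)))) + 1 := by
    simpa only [star_add, star_mul, star_gain, star_one, mul_assoc] using congrArg star hP
  have hrow5 : K.gain 5 4 = K.gain 5 0 * (K.gain 0 1 * K.gain 1 4) +
      -(K.gain 5 0 * (K.gain 0 1 * (K.gain 1 2 * (K.gain 2 3 * K.gain 3 4)))) := by
    have h := congrArg (fun x => K.gain 5 0 * x * (K.gain 0 5 * K.gain 5 4)) hP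
    simp (decide := true) only [mul_add, add_mul, mul_assoc, hK.gain_mul_gain_mul,
      hK.gain_mul_gain, mul_one] at h
    rw [h]
    abel
  -- This is column 1 of row 4. Multiplying the conjugated condition by the gain of the 4-cycle
  -- turns its left side into 1, and the factor `K.gain 4 1` then isolates the chord.
  have hrow4 : K.gain 4 1 = K.gain 4 5 * (K.gain 5 0 * K.gain 0 1) +
      K.gain 4 3 * (K.gain 3 2 * K.gain 2 1) := by
    have h' := congrArg (fun x => K.gain 0 1 * (K.gain 1 4 * (K.gain 4 5 * K.gain 5 0)) * x) hP'
    simp (decide := true) only [mul_add, mul_assoc, hK.gain_mul_gain_mul,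
      hK.gain_mul_gain, mul_one] at h'
    have := congrArg (fun x => K.gain 4 1 * (K.gain 1 0 * (x * K.gain 0 1))) h'.symm
    simp (decide := true) only [mul_add, add_mul, mul_assoc, hK.gain_mul_gain_mul,
      hK.gain_mul_gain, mul_one, one_mul] at this
    rw [← this, add_comm]
  refine rank_eq_four_of_two_edges (a := 0) (b := 1) (c := 2) (d := 3) (hK.adj rfl)
    (hK.adj rfl) (hK.not_adj rfl) (hK.not_adj rfl) fun v => ?_
  fin_cases v
  · tauto
  · tauto
  · tauto
  · tauto
  · refine Or.inr <| Or.inr <| Or.inr <| Or.inr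
      ⟨K.gain 4 5 * K.gain 5 0, 0, K.gain 4 3 * K.gain 3 2, 0, fun w => ?_⟩
    fin_cases w <;> simp (decide := true) [hK.gain_eq_zero, hK.gain_mul_gain,
      mul_assoc, hrow4]
  · refine Or.inr <| Or.inr <| Or.inr <| Or.inr
      ⟨0, K.gain 5 0 * K.gain 0 1, 0, -(K.gain 5 0 * K.gain 0 1 * K.gain 1 2 * K.gain 2 3), fun w => ?_⟩
    fin_cases w <;> simp (decide := true) [hK.gain_eq_zero, hK.gain_mul_gain,
      mul_assoc, hrow5]

/-! ### `K_{2,3}`, with pendant vertices or paths and alone. -/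

theorem IsK23PendantDegTwo.rank_eq {K : QuatGainGraph (Fin 6)} (h : K.IsK23PendantDegTwo) :
    K.rank = 4 := by
  obtain ⟨hG, h1⟩ := h
  have hK : K.HasEdges
      [(0, 1), (1, 2), (2, 3), (3, 0), (1, 4), (4, 3), (4, 5)] := by
    simp only [HasEdges, hG, edgesK23, SimpleGraph.fromEdgeSet_adj, Set.mem_union,
      Set.mem_insert_iff, Set.mem_singleton_iff]
    decide
  have e1 := h1.gain_eq (hK.adj rfl) (hK.adj rfl) (hK.adj rfl)
  have e2 := h1.reverse.rotate.rotate.gain_eq (hK.adj rfl) (hK.adj rfl) (hK.adj rfl)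
  refine rank_eq_four_of_two_edges (a := 5) (b := 4) (c := 0) (d := 1) (hK.adj rfl)
    (hK.adj rfl) (hK.not_adj rfl) (hK.not_adj rfl) fun v => ?_
  fin_cases v
  · tauto
  · tauto
  · refine Or.inr <| Or.inr <| Or.inr <| Or.inr
      ⟨0, 0, K.gain 2 1 * K.gain 1 0, 0, fun w => ?_⟩
    fin_cases w <;> simp (decide := true) [hK.gain_eq_zero, hK.gain_mul_gain,
      mul_assoc, e1]
  · refine Or.inr <| Or.inr <| Or.inr <| Or.inr
      ⟨(K.gain 3 4 - K.gain 3 0 * K.gain 0 1 * K.gain 1 4) * K.gain 4 5, 0, 0, K.gain 3 0 * K.gain 0 1, fun w => ?_⟩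
    fin_cases w <;> simp (decide := true) [hK.gain_eq_zero, hK.gain_mul_gain,
      mul_assoc, e2]
  · tauto
  · tauto

/-- Without the pendant edge only a star centred at 3 remains, which has rank 2 for any gains. -/
theorem IsK23PendantDegThree.rank_eq {K : QuatGainGraph (Fin 6)} (h : K.IsK23PendantDegThree) :
    K.rank = 4 := by
  have hG : K.graph = _ := h
  have hK : K.HasEdges
      [(0, 1), (1, 2), (2, 3), (3, 0), (1, 4), (4, 3), (1, 5)] := by
    simp only [HasEdges, hG, edgesK23, SimpleGraph.fromEdgeSet_adj, Set.mem_union,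
      Set.mem_insert_iff, Set.mem_singleton_iff]
    decide
  refine rank_eq_four_of_two_edges (a := 5) (b := 1) (c := 0) (d := 3) (hK.adj rfl)
    (hK.adj rfl) (hK.not_adj rfl) (hK.not_adj rfl) fun v => ?_
  fin_cases v
  · tauto
  · tauto
  · refine Or.inr <| Or.inr <| Or.inr <| Or.inr
      ⟨(K.gain 2 1 - K.gain 2 3 * K.gain 3 0 * K.gain 0 1) * K.gain 1 5, 0, K.gain 2 3 * K.gain 3 0, 0, fun w => ?_⟩
    fin_cases w <;> simp (decide := true) [hK.gain_eq_zero, hK.gain_mul_gain,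
      mul_assoc]
  · tauto
  · refine Or.inr <| Or.inr <| Or.inr <| Or.inr
      ⟨(K.gain 4 1 - K.gain 4 3 * K.gain 3 0 * K.gain 0 1) * K.gain 1 5, 0, K.gain 4 3 * K.gain 3 0, 0, fun w => ?_⟩
    fin_cases w <;> simp (decide := true) [hK.gain_eq_zero, hK.gain_mul_gain,
      mul_assoc]
  · tauto

/-- Every edge meets 1 or 3, and the two pendant rows are the unit vectors of these columns up to
units. -/
theorem IsK23TwoPendants.rank_eq {K : QuatGainGraph (Fin 7)} (h : K.IsK23TwoPendants) :
    K.rank = 4 := by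
  have hG : K.graph = _ := h
  have hK : K.HasEdges
      [(0, 1), (1, 2), (2, 3), (3, 0), (1, 4), (4, 3), (1, 5), (3, 6)] := by
    simp only [HasEdges, hG, edgesK23, SimpleGraph.fromEdgeSet_adj, Set.mem_union,
      Set.mem_insert_iff, Set.mem_singleton_iff]
    decide
  refine rank_eq_four_of_two_edges (a := 5) (b := 1) (c := 6) (d := 3) (hK.adj rfl)
    (hK.adj rfl) (hK.not_adj rfl) (hK.not_adj rfl) fun v => ?_
  fin_cases v
  · refine Or.inr <| Or.inr <| Or.inr <| Or.inr
      ⟨K.gain 0 1 * K.gain 1 5, 0, K.gain 0 3 * K.gain 3 6, 0, fun w => ?_⟩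
    fin_cases w <;> simp (decide := true) [hK.gain_eq_zero, hK.gain_mul_gain,
      mul_assoc]
  · tauto
  · refine Or.inr <| Or.inr <| Or.inr <| Or.inr
      ⟨K.gain 2 1 * K.gain 1 5, 0, K.gain 2 3 * K.gain 3 6, 0, fun w => ?_⟩
    fin_cases w <;> simp (decide := true) [hK.gain_eq_zero, hK.gain_mul_gain,
      mul_assoc]
  · tauto
  · refine Or.inr <| Or.inr <| Or.inr <| Or.inr
      ⟨K.gain 4 1 * K.gain 1 5, 0, K.gain 4 3 * K.gain 3 6, 0, fun w => ?_⟩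
    fin_cases w <;> simp (decide := true) [hK.gain_eq_zero, hK.gain_mul_gain,
      mul_assoc]
  · tauto
  · tauto

/-- Splitting off the end edge of the path leaves `K_{2,3}`, of rank 2 because within each part all
rows are proportional. -/
theorem IsK23PathDegThree.rank_eq {K : QuatGainGraph (Fin 7)} (h : K.IsK23PathDegThree) :
    K.rank = 4 := by
  obtain ⟨hG, h1, h2⟩ := h
  have hK : K.HasEdges
      [(0, 1), (1, 2), (2, 3), (3, 0), (1, 4), (4, 3), (1, 5), (5, 6)] := by
    simp only [HasEdges, hG, edgesK23, SimpleGraph.fromEdgeSet_adj, Set.mem_union,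
      Set.mem_insert_iff, Set.mem_singleton_iff]
    decide
  have e1 := h2.rotate.rotate.rotate.gain_eq (hK.adj rfl) (hK.adj rfl) (hK.adj rfl)
  have e2 := h1.rotate.rotate.rotate.gain_eq (hK.adj rfl) (hK.adj rfl) (hK.adj rfl)
  have e3 := h2.reverse.rotate.rotate.rotate.gain_eq (hK.adj rfl) (hK.adj rfl) (hK.adj rfl)
  have e4 := h1.reverse.rotate.rotate.rotate.gain_eq (hK.adj rfl) (hK.adj rfl) (hK.adj rfl)
  refine rank_eq_four_of_two_edges (a := 6) (b := 5) (c := 0) (d := 3) (hK.adj rfl)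
    (hK.adj rfl) (hK.not_adj rfl) (hK.not_adj rfl) fun v => ?_
  fin_cases v
  · tauto
  · refine Or.inr <| Or.inr <| Or.inr <| Or.inr
      ⟨K.gain 1 5 * K.gain 5 6, 0, 0, K.gain 1 0 * K.gain 0 3, fun w => ?_⟩
    fin_cases w <;> simp (decide := true) [hK.gain_eq_zero, hK.gain_mul_gain,
      mul_assoc, e1, e2]
  · refine Or.inr <| Or.inr <| Or.inr <| Or.inr
      ⟨0, 0, K.gain 2 3 * K.gain 3 0, 0, fun w => ?_⟩
    fin_cases w <;> simp (decide := true) [hK.gain_eq_zero, hK.gain_mul_gain,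
      mul_assoc, e3]
  · tauto
  · refine Or.inr <| Or.inr <| Or.inr <| Or.inr
      ⟨0, 0, K.gain 4 3 * K.gain 3 0, 0, fun w => ?_⟩
    fin_cases w <;> simp (decide := true) [hK.gain_eq_zero, hK.gain_mul_gain,
      mul_assoc, e4]
  · tauto
  · tauto

theorem IsK23PathDegTwo.rank_eq {K : QuatGainGraph (Fin 7)} (h : K.IsK23PathDegTwo) :
    K.rank = 4 := by
  obtain ⟨hG, h1, h2⟩ := h
  have hK : K.HasEdges
      [(0, 1), (1, 2), (2, 3), (3, 0), (1, 4), (4, 3), (4, 5), (5, 6)] := by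
    simp only [HasEdges, hG, edgesK23, SimpleGraph.fromEdgeSet_adj, Set.mem_union,
      Set.mem_insert_iff, Set.mem_singleton_iff]
    decide
  have e1 := h2.gain_eq (hK.adj rfl) (hK.adj rfl) (hK.adj rfl)
  have e2 := h2.reverse.rotate.rotate.gain_eq (hK.adj rfl) (hK.adj rfl) (hK.adj rfl)
  have e3 := h1.reverse.rotate.rotate.gain_eq (hK.adj rfl) (hK.adj rfl) (hK.adj rfl)
  have e4 := h1.gain_eq (hK.adj rfl) (hK.adj rfl) (hK.adj rfl)
  refine rank_eq_four_of_two_edges (a := 6) (b := 5) (c := 0) (d := 1) (hK.adj rfl)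
    (hK.adj rfl) (hK.not_adj rfl) (hK.not_adj rfl) fun v => ?_
  fin_cases v
  · tauto
  · tauto
  · refine Or.inr <| Or.inr <| Or.inr <| Or.inr
      ⟨0, 0, K.gain 2 1 * K.gain 1 0, 0, fun w => ?_⟩
    fin_cases w <;> simp (decide := true) [hK.gain_eq_zero, hK.gain_mul_gain,
      mul_assoc, e1]
  · refine Or.inr <| Or.inr <| Or.inr <| Or.inr
      ⟨0, 0, 0, K.gain 3 0 * K.gain 0 1, fun w => ?_⟩
    fin_cases w <;> simp (decide := true) [hK.gain_eq_zero, hK.gain_mul_gain,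
      mul_assoc, e2, e3]
  · refine Or.inr <| Or.inr <| Or.inr <| Or.inr
      ⟨K.gain 4 5 * K.gain 5 6, 0, K.gain 4 1 * K.gain 1 0, 0, fun w => ?_⟩
    fin_cases w <;> simp (decide := true) [hK.gain_eq_zero, hK.gain_mul_gain,
      mul_assoc, e4]
  · tauto
  · tauto

theorem IsTheta111.rank_eq {K : QuatGainGraph (Fin 5)} (h : K.IsTheta111) : K.rank = 4 := by
  obtain ⟨hG, h⟩ := h
  have hK : K.HasEdges [(0, 1), (1, 2), (2, 3), (3, 0), (1, 4), (4, 3)] := by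
    simp only [HasEdges, hG, edgesK23, SimpleGraph.fromEdgeSet_adj, Set.mem_insert_iff,
      Set.mem_singleton_iff]
    decide
  -- Whichever 4-cycle is of Type 2, the remaining vertex `e` has its row supported on columns 1 and
  -- 3, where rows `a` and `c` span everything.
  have key : ∀ a c e, K.IsType2 [a, 1, c, 3] → K.graph.Adj a 1 → K.graph.Adj 1 c →
      K.graph.Adj c 3 → K.graph.Adj 3 a → (∀ w, w ≠ 1 → w ≠ 3 → K.gain a w = 0 ∧ K.gain c w = 0 ∧
      K.gain e w = 0) → ¬ K.graph.Adj a c → (∀ v, v = a ∨ v = 1 ∨ v = c ∨ v = 3 ∨ v = e) →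
      K.rank = 4 := by
    intro a c e h2 ha1 h1c hc3 h3a hw hac hv
    refine rank_eq_four_of_isType2 ha1 h1c hc3 h3a hac (hK.not_adj rfl) h2 fun v => ?_
    rcases hv v with h | h | h | h | rfl
    · exact Or.inl h
    · exact Or.inr (Or.inl h)
    · exact Or.inr (Or.inr (Or.inl h))
    · exact Or.inr (Or.inr (Or.inr (Or.inl h)))
    obtain ⟨p, r, h1, h3⟩ := h2.exists_row_eq ha1 h1c h3a (K.gain v 1) (K.gain v 3)
    refine Or.inr (Or.inr (Or.inr (Or.inr ⟨p, 0, r, 0, fun w => ?_⟩)))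
    by_cases hw1 : w = 1
    · simp [hw1, h1]
    by_cases hw3 : w = 3
    · simp [hw3, h3]
    simp [hw w hw1 hw3]
  have hz : ∀ w, w ≠ 1 → w ≠ 3 → K.gain 0 w = 0 ∧ K.gain 2 w = 0 ∧ K.gain 4 w = 0 := by
    intro w h1 h3
    fin_cases w <;> simp (decide := true) [hK.gain_eq_zero] at h1 h3 ⊢
  rcases h with ⟨-, h⟩ | ⟨h, -⟩
  · exact key 0 4 2 h (hK.adj rfl) (hK.adj rfl) (hK.adj rfl) (hK.adj rfl)
      (fun w h1 h3 => ⟨(hz w h1 h3).1, (hz w h1 h3).2.2, (hz w h1 h3).2.1⟩)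
      (hK.not_adj rfl) (by decide)
  · exact key 0 2 4 h (hK.adj rfl) (hK.adj rfl) (hK.adj rfl) (hK.adj rfl) hz
      (hK.not_adj rfl) (by decide)

/-! ### The 4-cycle alone and with stars attached or joined. -/

theorem exists_relabel_graph_eq [Finite V] [Finite W] (G : QuatGainGraph V) {H : SimpleGraph W}
    (e : H ≃g G.graph) : (G.relabel e.symm.toEquiv).graph = H ∧
      (G.relabel e.symm.toEquiv).rank = G.rank := by
  refine ⟨?_, rank_relabel _ _⟩
  ext u v
  exact e.map_adj_iff

theorem IsC4Type2.rank_eq {G : QuatGainGraph V} (h : G.IsC4Type2) : G.rank = 4 := by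
  obtain ⟨e, h⟩ := h
  refine rank_eq_four_of_isType2 (e.map_adj_iff.2 (by decide)) (e.map_adj_iff.2 (by decide))
    (e.map_adj_iff.2 (by decide)) (e.map_adj_iff.2 (by decide))
    (fun h => absurd (e.map_adj_iff.1 h) (by decide))
    (fun h => absurd (e.map_adj_iff.1 h) (by decide)) h fun v => ?_
  obtain ⟨i, rfl⟩ := e.surjective v
  fin_cases i <;> tauto

theorem attachStar_adj_inl (G : SimpleGraph V) (v x y : V) (p : ℕ) :
    (attachStar G v p).Adj (Sum.inl x) (Sum.inl y) ↔ G.Adj x y := by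
  simp [attachStar]

theorem attachStar_adj_inr (G : SimpleGraph V) (v : V) (p : ℕ) (i : Fin p) (x : V ⊕ Fin p) :
    (attachStar G v p).Adj (Sum.inr i) x ↔ x = Sum.inl v := by
  rcases x with x | x <;> simp [attachStar]

theorem IsC4OneStar.rank_eq [Finite V] {G : QuatGainGraph V} (h : G.IsC4OneStar) :
    G.rank = 4 := by
  obtain ⟨p, i, hp, ⟨e⟩⟩ := h
  obtain ⟨hK, hr⟩ := G.exists_relabel_graph_eq e
  rw [← hr]
  generalize G.relabel e.symm.toEquiv = K at hK
  clear hr e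
  -- The opposite vertices `i` and `i + 2` cover all edges, and `i + 1` is adjacent to these two
  -- only.
  refine rank_eq_four_of_edges_meet (a := Sum.inr ⟨0, hp⟩) (b := Sum.inl i)
    (c := Sum.inl (i + 1)) (d := Sum.inl (i + 2)) ?_ ?_ ?_ ?_ ?_ ?_ ?_ <;> try rw [hK]
  · rw [attachStar_adj_inr]
  · exact fun w => (attachStar_adj_inr _ _ _ _ _).1
  · rw [attachStar_adj_inl]; clear hK; revert i; decide
  · rw [ne_eq, Sum.inl.injEq]; clear hK; revert i; decide
  · rw [ne_eq, Sum.inl.injEq]; clear hK; revert i; decide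
  · rintro (w | w)
    · rw [attachStar_adj_inl, Sum.inl.injEq, Sum.inl.injEq]; clear hK; revert i w; decide
    · rw [SimpleGraph.adj_comm, attachStar_adj_inr, Sum.inl.injEq]
      exact fun h => absurd h (by clear hK; revert i; decide)
  · rintro (v | v) (w | w)
    · simp only [attachStar_adj_inl, Sum.inl.injEq]; clear hK; revert i v w; decide
    · rw [SimpleGraph.adj_comm, attachStar_adj_inr]; tauto
    · rw [attachStar_adj_inr]; tauto
    · rw [attachStar_adj_inr]; tauto

theorem IsC4TwoStars.rank_eq [Finite V] {G : QuatGainGraph V} (h : G.IsC4TwoStars) :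
    G.rank = 4 := by
  obtain ⟨p, q, i, j, hp, hq, hij, hadj, ⟨e⟩⟩ := h
  obtain ⟨hK, hr⟩ := G.exists_relabel_graph_eq e
  rw [← hr]
  generalize G.relabel e.symm.toEquiv = K at hK
  clear hr e
  -- The two star centres are opposite on the cycle, so they cover all edges; one leaf of each
  -- supplies `a` and `c`.
  refine rank_eq_four_of_edges_meet (a := Sum.inl (Sum.inr ⟨0, hp⟩)) (b := Sum.inl (Sum.inl i))
    (c := Sum.inr ⟨0, hq⟩) (d := Sum.inl (Sum.inl j)) ?_ ?_ ?_ ?_ ?_ ?_ ?_ <;> try rw [hK]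
  · rw [attachStar_adj_inl, attachStar_adj_inr]
  · rintro (w | w)
    · rw [attachStar_adj_inl, attachStar_adj_inr]
      exact congrArg Sum.inl
    · rw [SimpleGraph.adj_comm, attachStar_adj_inr]
      simp
  · rw [attachStar_adj_inr]
  · simp
  · simpa using hij.symm
  · intro w
    rw [attachStar_adj_inr]
    exact Or.inr
  · rintro ((v | v) | v) ((w | w) | w)
    · simp only [attachStar_adj_inl, Sum.inl.injEq]; clear hK; revert i j v w; decide
    · rw [attachStar_adj_inl, SimpleGraph.adj_comm, attachStar_adj_inr, Sum.inl.injEq]; tauto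
    · rw [SimpleGraph.adj_comm, attachStar_adj_inr]; tauto
    · rw [attachStar_adj_inl, attachStar_adj_inr, Sum.inl.injEq (Sum.inl w)]; tauto
    · rw [attachStar_adj_inl, attachStar_adj_inr]; simp
    · rw [SimpleGraph.adj_comm, attachStar_adj_inr]; tauto
    · rw [attachStar_adj_inr]; tauto
    · rw [attachStar_adj_inr]; tauto
    · rw [attachStar_adj_inr]; tauto

theorem joinStar_adj_inl (G : SimpleGraph V) (v x y : V) (q : ℕ) :
    (joinStar G v q).Adj (Sum.inl x) (Sum.inl y) ↔ G.Adj x y := by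
  simp [joinStar, SimpleGraph.edge_adj]

theorem joinStar_adj_inr (G : SimpleGraph V) (v : V) (q : ℕ) (i : Fin (q + 1)) (hi : i ≠ 0)
    (x : V ⊕ Fin (q + 1)) : (joinStar G v q).Adj (Sum.inr i) x ↔ x = Sum.inr 0 := by
  rcases x with x | x <;> simp [joinStar, SimpleGraph.edge_adj, hi]
  rintro rfl
  exact hi

theorem joinStar_adj_inl_inr (G : SimpleGraph V) (v x : V) (q : ℕ) (i : Fin (q + 1))
    (hi : i ≠ 0) : ¬ (joinStar G v q).Adj (Sum.inl x) (Sum.inr i) := by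
  rw [SimpleGraph.adj_comm, joinStar_adj_inr _ _ _ _ hi]
  simp

theorem IsC4Type1JoinStar.rank_eq [Finite V] {G : QuatGainGraph V} (h : G.IsC4Type1JoinStar) :
    G.rank = 4 := by
  obtain ⟨q, i, hq, e, h1⟩ := h
  obtain ⟨hK, hr⟩ := G.exists_relabel_graph_eq e
  rw [← hr]
  have h1 : (G.relabel e.symm.toEquiv).IsType1
      [Sum.inl 0, Sum.inl 1, Sum.inl 2, Sum.inl 3] := by
    rw [isType1_four] at h1 ⊢
    exact h1
  generalize G.relabel e.symm.toEquiv = K at hK h1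
  -- With `q` a successor, `1` differs from the centre `0` and names a leaf.
  obtain ⟨q, rfl⟩ := Nat.exists_eq_add_of_le' hq
  have hC : ∀ x y, K.graph.Adj (Sum.inl x) (Sum.inl y) ↔
      listAdj [(0, 1), (1, 2), (2, 3), (3, 0)] x y = true := by
    simp only [hK, joinStar_adj_inl]
    decide
  have hz : ∀ x i, i ≠ 0 → K.gain (Sum.inl x) (Sum.inr i) = 0 := by
    intro x i hi
    apply K.gain_eq_zero
    rw [hK]
    exact joinStar_adj_inl_inr _ _ _ _ _ hi
  have e2 := h1.gain_eq ((hC _ _).2 rfl) ((hC _ _).2 rfl) ((hC _ _).2 rfl)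
  have e3 := h1.reverse.rotate.rotate.gain_eq ((hC _ _).2 rfl)
    ((hC _ _).2 rfl) ((hC _ _).2 rfl)
  have hd : ∀ x y, listAdj [(0, 1), (1, 2), (2, 3), (3, 0)] x y = false →
      K.gain (Sum.inl x) (Sum.inl y) = 0 := fun x y h =>
    K.gain_eq_zero _ _ fun h' => Bool.false_ne_true (h.symm.trans ((hC x y).1 h'))
  refine rank_eq_four_of_pendant (a := Sum.inr 1) (b := Sum.inr 0) (c := Sum.inl 0)
    (d := Sum.inl 1) ?_ ?_ ?_ ?_ ?_ ?_
  · rw [hK, joinStar_adj_inr _ _ _ _ (by simp)]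
  · intro w
    rw [hK, joinStar_adj_inr _ _ _ _ (by simp)]
    exact id
  · exact (hC _ _).2 rfl
  · simp
  · simp
  rintro (v | v)
  · right
    have key : ∃ r s : ℍ[ℝ], ∀ w, K.gain (Sum.inl v) (Sum.inl w) =
        r * K.gain (Sum.inl 0) (Sum.inl w) + s * K.gain (Sum.inl 1) (Sum.inl w) := by
      have hu : ∀ x y, listAdj [(0, 1), (1, 2), (2, 3), (3, 0)] x y = true →
          K.gain (Sum.inl x) (Sum.inl y) * K.gain (Sum.inl y) (Sum.inl x) = 1 :=
        fun x y h => K.gain_mul_gain ((hC x y).2 h)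
      fin_cases v
      · exact ⟨1, 0, fun w => by simp⟩
      · exact ⟨0, 1, fun w => by simp⟩
      · refine ⟨K.gain (Sum.inl 2) (Sum.inl 1) * K.gain (Sum.inl 1) (Sum.inl 0), 0, fun w => ?_⟩
        fin_cases w <;>
          simp [hd 2 0 rfl, hd 0 0 rfl, hd 2 2 rfl, hd 0 2 rfl, hu 1 0 rfl, mul_assoc, e2]
      · refine ⟨0, K.gain (Sum.inl 3) (Sum.inl 0) * K.gain (Sum.inl 0) (Sum.inl 1), fun w => ?_⟩
        fin_cases w <;>
          simp [hd 3 1 rfl, hd 1 1 rfl, hd 3 3 rfl, hd 1 3 rfl, hu 0 1 rfl, mul_assoc, e3]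
    obtain ⟨r, s, h⟩ := key
    refine ⟨r, s, ?_⟩
    rintro (w | w) hw
    · exact h w
    · have hw0 : w ≠ 0 := fun h => hw (congrArg Sum.inr h)
      simp [hz _ _ hw0]
  · by_cases hv : v = 0
    · exact Or.inl (congrArg Sum.inr hv)
    -- A leaf's row vanishes off the column of the centre.
    · refine Or.inr ⟨0, 0, fun w hw => ?_⟩
      rw [K.gain_eq_zero, zero_mul, zero_mul, add_zero]
      rw [hK, joinStar_adj_inr _ _ _ _ hv]
      exact hw

end QuatGainGraph

end

theorem theorem5p10 {V : Type*} [Fintype V] (G : QuatGainGraph V)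
    (hconn : G.graph.Connected) (hgirth : G.graph.girth = 4)
    (hG : G.IsC4Type2 ∨
      (G.IsC4OneStar ∨ G.IsC4TwoStars) ∨
      G.IsC4Type1JoinStar ∨
      (G.ReducesIntoClass QuatGainGraph.IsTwoC4CommonVertex ∨ G.ReducesIntoClass QuatGainGraph.IsHexagonChord ∨
        G.ReducesIntoClass QuatGainGraph.IsTheta111 ∨ G.ReducesIntoClass QuatGainGraph.IsTheta112 ∨
        G.ReducesIntoClass QuatGainGraph.IsTheta113) ∨
      (G.ReducesIntoClass QuatGainGraph.IsK23PendantDegTwo ∨ G.ReducesIntoClass QuatGainGraph.IsK23PendantDegThree ∨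
        G.ReducesIntoClass QuatGainGraph.IsK23TwoPendants ∨ G.ReducesIntoClass QuatGainGraph.IsK23PathDegThree ∨
        G.ReducesIntoClass QuatGainGraph.IsK23PathDegTwo)) :
    G.rank = G.graph.girth := by
  rw [hgirth]
  rcases hG with h | (h | h) | h | (h | h | h | h | h) | (h | h | h | h | h)
  · exact h.rank_eq
  · exact h.rank_eq
  · exact h.rank_eq
  · exact h.rank_eq
  · exact h.rank_eq fun _ hK => hK.rank_eq
  · exact h.rank_eq fun _ hK => hK.rank_eq
  · exact h.rank_eq fun _ hK => hK.rank_eq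
  · exact h.rank_eq fun _ hK => hK.rank_eq
  · exact h.rank_eq fun _ hK => hK.rank_eq
  · exact h.rank_eq fun _ hK => hK.rank_eq
  · exact h.rank_eq fun _ hK => hK.rank_eq
  · exact h.rank_eq fun _ hK => hK.rank_eq
  · exact h.rank_eq fun _ hK => hK.rank_eq
  · exact h.rank_eq fun _ hK => hK.rank_eq
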